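/- Let $\mathcal E$ be a cartesian closed category with terminal object $1$; a point of $X$ is an arrow $1\to X$. A *homotopy theory* on $\mathcal E$ is a natural transformation $p:1_{\mathcal E}\Rightarrow\Pi_0:\mathcal E\to\mathcal E$ such that $\Pi_0$ preserves finite products and, for every $X$, each point of $\Pi_0(X)$ is of the form $p_X\circ x$ for some point $x$ of $X$. Two arrows $f,g:X\to Y$ are *$p$-homotopic* if their names $\ulcorner f\urcorner,\ulcorner g\urcorner:1\to Y^X$ satisfy $p_{Y^X}\circ\ulcorner f\urcorner=p_{Y^X}\circ\ulcorner g\urcorner$. An object $A$ is *$p$-contractible* if there is a point $a:1\to A$ such that the constant map $A\to 1\xrightarrow{a}A$ is $p$-homotopic to $1_A$. An object $X$ is *connected* if $\Pi_0(X)=1$ (that is, $\Pi_0(X)$ is a terminal object). For objects $A,X$ let $\sigma_X:X\to X^A$ be the transpose of the projection $X\times A\to X$. **Theorem D.** (I) Let $p:1_{\mathcal E}\Rightarrow\Pi_0$ be a homotopy theory on a cartesian closed category $\mathcal E$, and let $A$ be an object of $\mathcal E$. The following are equivalent: 1. $A$ is $p$-contractible; 2. for every object $X$, the arrow $\Pi_0(\sigma_X):\Pi_0(X)\to\Pi_0(X^A)$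 is an isomorphism. (II) Let $\mathcal E$ be an elementary topos satisfying the following three postulates, where an object $D$ is *decidable* if its diagonal $D\to D\times D$ is a complemented subobject. * NS: every non-initial object has a point. * WDQO: every object $X$ has a minimal decidable object that uniquely factors arrows to $1+1$, that is, an arrow $p_X:X\to\Pi(X)$ with $\Pi(X)$ decidable such that every arrow $X\to 1+1$ factors through $p_X$ in exactly one way, and such that no proper decidable subobject of $\Pi(X)$ through which $p_X$ factors has this same property. * DSO: every object has a unique decidable subobject containing all of its points. Then there is a natural transformation $p:1_{\mathcal E}\Rightarrow\Pi_0:\mathcal E\to\mathcal E$ whose components are arrows $p_X$ as in WDQO, and every such $p$ is a homotopy theory on $\mathcal E$. For every such $p$ and every object $A$ of $\mathcal E$, conditions 1 and 2 are also equivalent to each of the following: 3. for every object $X$, the object $A^X$ is connected; 4. $A$ has a point and $A^A$ is connected. -/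

import Mathlib

open CategoryTheory Limits MonoidalCategory CartesianMonoidalCategory

universe v u

namespace HomotopyTheory

variable {E : Type u} [Category.{v} E] [CartesianMonoidalCategory E]

section CartesianClosed

variable [MonoidalClosed E]

/-- A natural transformation `p : 𝟭 E ⟶ P` (with `P` the functor written `Π₀`) is a homotopy theory
on the cartesian closed category `E` if `P` preserves finite products and every point of `P X` is
the image under `p_X` of a point of `X`. -/
structure IsHomotopyTheory {P : E ⥤ E} (p : 𝟭 E ⟶ P) : Prop where
  preservesFiniteProducts : PreservesFiniteProducts P
  surjective_points : ∀ X : E,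
    Function.Surjective (fun x : 𝟙_ E ⟶ X => (x ≫ p.app X : 𝟙_ E ⟶ P.obj X))

/-- `f, g : X ⟶ Y` are `p`-homotopic if their names `𝟙_ E ⟶ Y ^ X` become equal after composition
with the component of `p` at `Y ^ X`. -/
def Homotopic {P : E ⥤ E} (p : 𝟭 E ⟶ P) {X Y : E} (f g : X ⟶ Y) : Prop :=
  internalizeHom f ≫ p.app ((ihom X).obj Y) = internalizeHom g ≫ p.app ((ihom X).obj Y)

/-- `A` is `p`-contractible if there is a point `a` of `A` such that the constant map
`A ⟶ 𝟙_ E ⟶ A` at `a` is `p`-homotopic to the identity. -/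
def IsContractible {P : E ⥤ E} (p : 𝟭 E ⟶ P) (A : E) : Prop :=
  ∃ a : 𝟙_ E ⟶ A, Homotopic p (toUnit A ≫ a) (𝟙 A)

/-- The arrow `σ_X : X ⟶ X ^ A`, the transpose of the projection to `X` from the product
of `X` and `A`. -/
def sigma (A X : E) : X ⟶ (ihom A).obj X :=
  MonoidalClosed.curry (snd A X)

/-- `X` is connected with respect to the endofunctor `P`: the object `P X` is terminal. -/
def IsConnectedFor (P : E ⥤ E) (X : E) : Prop :=
  Nonempty (IsTerminal (P.obj X))

variable (E) in
/-- The cartesian closed category `E` is an elementary topos: it has finite limits and a subobject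
classifier. -/
structure IsElementaryTopos : Prop where
  hasFiniteLimits : HasFiniteLimits E
  hasSubobjectClassifier : HasSubobjectClassifier E

end CartesianClosed

/-- `X` is decidable: the diagonal `X ⟶ X ⊗ X` is a complemented subobject, i.e. it is one of the
two injections of a coproduct decomposition of `X ⊗ X`. -/
def IsDecidable (X : E) : Prop :=
  ∃ (C : E) (c : C ⟶ X ⊗ X), Nonempty (IsColimit (BinaryCofan.mk (lift (𝟙 X) (𝟙 X)) c))

/-- `p : X ⟶ D` uniquely factors arrows to `1 + 1`: every arrow from `X` to the coproduct `T` of two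
copies of the terminal object factors through `p` in exactly one way. -/
def UniquelyFactorsArrowsToTwo {X D : E} (p : X ⟶ D) : Prop :=
  ∃ (T : E) (i j : 𝟙_ E ⟶ T), Nonempty (IsColimit (BinaryCofan.mk i j)) ∧
    ∀ f : X ⟶ T, ∃! g : D ⟶ T, p ≫ g = f

/-- `p : X ⟶ D` is a minimal decidable object that uniquely factors arrows to `1 + 1`: it is a
decidable object with this property, and no proper decidable subobject of `D` through which `p`
factors has the property. -/
structure IsMinimalDecidable {X D : E} (p : X ⟶ D) : Prop where
  isDecidable : IsDecidable D
  uniquelyFactors : UniquelyFactorsArrowsToTwo p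
  minimal : ∀ (D' : E) (m : D' ⟶ D) (q : X ⟶ D'), Mono m → q ≫ m = p →
    IsDecidable D' → UniquelyFactorsArrowsToTwo q → IsIso m

variable (E) in
/-- The Nullstellensatz postulate: every non-initial object has a point. -/
def NS : Prop :=
  ∀ X : E, ¬ Nonempty (IsInitial X) → Nonempty (𝟙_ E ⟶ X)

variable (E) in
/-- The WDQO postulate: every object has a minimal decidable object that uniquely factors its
arrows to `1 + 1`. -/
def WDQO : Prop :=
  ∀ X : E, ∃ (D : E) (p : X ⟶ D), IsMinimalDecidable p

variable (E) in
/-- McLarty's DSO postulate: every object has a unique decidable subobject containing all of its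
points. -/
def DSO : Prop :=
  ∀ X : E, ∃! S : Subobject X, IsDecidable (S : E) ∧ ∀ x : 𝟙_ E ⟶ X, S.Factors x

/-- The natural transformation `p : 𝟭 E ⟶ P` is the one associated with the WDQO postulate: each of
its components is a minimal decidable object that uniquely factors arrows to `1 + 1`. -/
def IsAssociated {P : E ⥤ E} (p : 𝟭 E ⟶ P) : Prop :=
  ∀ X : E, IsMinimalDecidable (p.app X : X ⟶ P.obj X)

end HomotopyTheory

/-! As `P` preserves products, two members of a family `B ⊗ Z ⟶ W` have the same image under `P`
once `p` identifies their parameters (`map_lift_comp_eq`). Apply this to internal composition with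
`B = A ^ A`, the parameters being the names of the identity and of a constant map. Precomposition
then yields an inverse of `P.map (sigma A X)`; postcomposition makes the identity of `P (A ^ X)`
factor through the terminal `P (1 ^ X)`. For the way back from invertibility of `P.map (sigma A A)`,
a point is lifted along `p`. All four conditions are thus equivalent for every homotopy theory, and
(II) reduces to showing that the associated `p` exist and are homotopy theories.

There `1 + 1` acts as an object of truth values: an object is decidable when its equality is an
arrow to `1 + 1`, and one may argue by cases on such an arrow (`hom_ext_of_cover`, `exists_glue`).
By NS, points separate arrows into decidable objects; with DSO, an arrow between decidable objects
that is bijective on points is invertible. Minimality makes `p_X` surjective on points, since a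
missed point could be removed. Every arrow from `X` to a decidable object then factors uniquely
through `p_X`, which gives functoriality; preservation of products is checked on points. -/

namespace HomotopyTheory

/-! ### Contractibility in an arbitrary homotopy theory. -/

section HomotopyTheories

variable {E : Type u} [Category.{v} E] [CartesianMonoidalCategory E]

@[simp]
lemma point_comp_toUnit_comp {W X : E} (a : 𝟙_ E ⟶ W) (x : 𝟙_ E ⟶ X) : a ≫ toUnit W ≫ x = x := by
  rw [← Category.assoc, comp_toUnit, toUnit_unit, Category.id_comp]

variable {P : E ⥤ E} {p : 𝟭 E ⟶ P}

lemma hom_ext_of_preservesFiniteProducts [PreservesFiniteProducts P] {W X Y : E}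
    {g g' : W ⟶ P.obj (X ⊗ Y)} (h₁ : g ≫ P.map (fst X Y) = g' ≫ P.map (fst X Y))
    (h₂ : g ≫ P.map (snd X Y) = g' ≫ P.map (snd X Y)) : g = g' := by
  rw [← cancel_mono (CartesianMonoidalCategory.prodComparison P X Y)]
  ext <;> simpa

lemma isIso_app_unit [PreservesFiniteProducts P] : IsIso (p.app (𝟙_ E)) := by
  have h : p.app (𝟙_ E) ≫ terminalComparison P = 𝟙 (𝟙_ E) := toUnit_unique _ _
  have : IsIso (p.app (𝟙_ E) ≫ terminalComparison P) := by rw [h]; exact IsIso.id (𝟙_ E)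
  exact IsIso.of_isIso_comp_right _ (terminalComparison P)

/-- Points identified by `p` have the same image under the functor. -/
lemma map_eq_map_of_comp_app_eq [PreservesFiniteProducts P] {X : E} {x y : 𝟙_ E ⟶ X}
    (h : x ≫ p.app X = y ≫ p.app X) : P.map x = P.map y := by
  have : IsIso (p.app (𝟙_ E)) := isIso_app_unit
  rw [← cancel_epi (p.app (𝟙_ E)), ← p.naturality, ← p.naturality]
  exact h

/-- The functor of a homotopy theory identifies two members of a family of arrows `Z ⟶ W`
parametrised by `B` as soon as the parameters are identified by `p`. -/
lemma map_lift_comp_eq [PreservesFiniteProducts P] {B Z W : E} (k : B ⊗ Z ⟶ W) {b b' : 𝟙_ E ⟶ B}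
    (h : b ≫ p.app B = b' ≫ p.app B) :
    P.map (lift (toUnit Z ≫ b) (𝟙 Z) ≫ k) = P.map (lift (toUnit Z ≫ b') (𝟙 Z) ≫ k) := by
  rw [P.map_comp, P.map_comp]
  congr 1
  apply hom_ext_of_preservesFiniteProducts
  · simp [← P.map_comp, -Functor.map_comp]
    simp [map_eq_map_of_comp_app_eq h]
  · simp [← P.map_comp, -Functor.map_comp]

lemma map_lift_comp_eq' [PreservesFiniteProducts P] {B Z W : E} (k : Z ⊗ B ⟶ W) {b b' : 𝟙_ E ⟶ B}
    (h : b ≫ p.app B = b' ≫ p.app B) :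
    P.map (lift (𝟙 Z) (toUnit Z ≫ b) ≫ k) = P.map (lift (𝟙 Z) (toUnit Z ≫ b') ≫ k) := by
  have := map_lift_comp_eq (lift (snd B Z) (fst B Z) ≫ k) h
  simpa only [comp_lift_assoc, lift_fst, lift_snd] using this

variable [MonoidalClosed E]

/-- Evaluation of the name of an arrow. -/
lemma lift_internalizeHom_ev {W X Y : E} (x : W ⟶ X) (f : X ⟶ Y) :
    lift x (toUnit W ≫ internalizeHom f) ≫ (ihom.ev X).app Y = x ≫ f := by
  have h : lift x (toUnit W ≫ internalizeHom f) =
      lift x (toUnit W) ≫ X ◁ internalizeHom f := by simp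
  rw [h, Category.assoc, internalizeHom, ← MonoidalClosed.uncurry_eq,
    MonoidalClosed.uncurry_curry, lift_fst_assoc]

/-- Internal composition of arrows, in the order of application. -/
def ihomComp (X Y Z : E) : (ihom Y).obj Z ⊗ (ihom X).obj Y ⟶ (ihom X).obj Z :=
  MonoidalClosed.curry (lift (lift (fst _ _) (snd _ _ ≫ snd _ _) ≫ (ihom.ev X).app Y)
    (snd _ _ ≫ fst _ _) ≫ (ihom.ev Y).app Z)

lemma uncurry_comp_ihomComp {W X Y Z : E} (g : W ⟶ (ihom Y).obj Z) (f : W ⟶ (ihom X).obj Y) :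
    MonoidalClosed.uncurry (lift g f ≫ ihomComp X Y Z) =
      lift (MonoidalClosed.uncurry f) (snd _ _ ≫ g) ≫ (ihom.ev Y).app Z := by
  rw [MonoidalClosed.uncurry_natural_left, ihomComp, MonoidalClosed.uncurry_curry,
    MonoidalClosed.uncurry_eq, ← Category.assoc]
  congr 1
  ext
  · simp only [Category.assoc, lift_fst, comp_lift_assoc, whiskerLeft_fst,
      whiskerLeft_snd_assoc, lift_snd]
    congr 1
    ext <;> simp
  · simp

lemma lift_internalizeHom_ihomComp {X Y Z : E} (f : Y ⟶ Z) :
    lift (toUnit _ ≫ internalizeHom f) (𝟙 ((ihom X).obj Y)) ≫ ihomComp X Y Z =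
      (ihom X).map f := by
  apply MonoidalClosed.uncurry_injective
  rw [uncurry_comp_ihomComp, ← Category.assoc, comp_toUnit, lift_internalizeHom_ev,
    ← MonoidalClosed.uncurry_natural_right, Category.id_comp]

lemma lift_ihomComp_internalizeHom {X Y Z : E} (f : X ⟶ Y) :
    lift (𝟙 ((ihom Y).obj Z)) (toUnit _ ≫ internalizeHom f) ≫ ihomComp X Y Z =
      (MonoidalClosed.pre f).app Z := by
  apply MonoidalClosed.uncurry_injective
  rw [uncurry_comp_ihomComp, MonoidalClosed.uncurry_pre]
  have h : MonoidalClosed.uncurry (toUnit ((ihom Y).obj Z) ≫ internalizeHom f) = fst _ _ ≫ f := by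
    rw [MonoidalClosed.uncurry_natural_left, internalizeHom, MonoidalClosed.uncurry_curry]
    simp
  rw [h]
  congr 1
  ext <;> simp

/-- Evaluation at a point. -/
def evalAt {A : E} (a : 𝟙_ E ⟶ A) (X : E) : (ihom A).obj X ⟶ X :=
  lift (toUnit _ ≫ a) (𝟙 _) ≫ (ihom.ev A).app X

lemma comp_sigma {A X W : E} (x : W ⟶ X) :
    x ≫ sigma A X = MonoidalClosed.curry (snd A W ≫ x) := by
  rw [sigma, ← MonoidalClosed.curry_natural_left, whiskerLeft_snd]

lemma sigma_evalAt {A : E} (a : 𝟙_ E ⟶ A) (X : E) : sigma A X ≫ evalAt a X = 𝟙 X := by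
  have h : sigma A X ≫ lift (toUnit _ ≫ a) (𝟙 _) =
      lift (toUnit X ≫ a) (𝟙 X) ≫ A ◁ sigma A X := by
    ext <;> simp
  rw [evalAt, reassoc_of% h, sigma, ← MonoidalClosed.uncurry_eq, MonoidalClosed.uncurry_curry,
    lift_snd]

lemma evalAt_sigma {A : E} (a : 𝟙_ E ⟶ A) (X : E) :
    evalAt a X ≫ sigma A X = (MonoidalClosed.pre (toUnit A ≫ a)).app X := by
  rw [comp_sigma, MonoidalClosed.curry_eq_iff, MonoidalClosed.uncurry_pre, evalAt,
    ← Category.assoc]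
  congr 1
  ext <;> simp

lemma internalizeHom_toUnit_comp {A X : E} (x : 𝟙_ E ⟶ X) :
    internalizeHom (toUnit A ≫ x) = x ≫ sigma A X := by
  rw [comp_sigma, internalizeHom]
  congr 1
  rw [← Category.assoc]
  congr 1
  exact toUnit_unique _ _

/-- The inverse is the image of evaluation at `a`: evaluating and then applying `sigma` is
precomposition with the constant map at `a`, which `P` identifies with precomposition with the
identity. -/
lemma isIso_map_sigma_of_isContractible [PreservesFiniteProducts P] {A : E}
    (hA : IsContractible p A) (X : E) : IsIso (P.map (sigma A X)) := by
  obtain ⟨a, ha⟩ := hA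
  refine ⟨P.map (evalAt a X), ?_, ?_⟩
  · rw [← P.map_comp, sigma_evalAt, P.map_id]
  · have := map_lift_comp_eq' (ihomComp A A X) ha
    rw [lift_ihomComp_internalizeHom, lift_ihomComp_internalizeHom] at this
    rw [← P.map_comp, evalAt_sigma, this, MonoidalClosed.pre_id]
    simp

/-- The class of the name of the identity, carried back to `P A`, lifts to a point `a`. By
naturality, `sigma` sends `a` to the name of a constant map in that same class. -/
lemma isContractible_of_isIso_map_sigma (hp : IsHomotopyTheory p) {A : E}
    [IsIso (P.map (sigma A A))] : IsContractible p A := by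
  obtain ⟨a, ha⟩ := hp.surjective_points A
    (internalizeHom (𝟙 A) ≫ p.app _ ≫ inv (P.map (sigma A A)))
  refine ⟨a, ?_⟩
  dsimp only at ha
  have h : sigma A A ≫ p.app ((ihom A).obj A) = p.app A ≫ P.map (sigma A A) :=
    p.naturality (sigma A A)
  rw [Homotopic, internalizeHom_toUnit_comp, Category.assoc, h, reassoc_of% ha]
  simp

theorem isContractible_iff_isIso_map_sigma (hp : IsHomotopyTheory p) (A : E) :
    IsContractible p A ↔ ∀ X : E, IsIso (P.map (sigma A X)) := by
  have := hp.preservesFiniteProducts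
  refine ⟨isIso_map_sigma_of_isContractible, fun h ↦ ?_⟩
  have := h A
  exact isContractible_of_isIso_map_sigma hp

lemma isConnectedFor_ihom_of_isContractible [PreservesFiniteProducts P] {A : E}
    (hA : IsContractible p A) (X : E) : IsConnectedFor P ((ihom X).obj A) := by
  obtain ⟨a, ha⟩ := hA
  have h := map_lift_comp_eq (ihomComp X A A) ha
  rw [lift_internalizeHom_ihomComp, lift_internalizeHom_ihomComp, (ihom X).map_id, P.map_id,
    (ihom X).map_comp] at h
  have hT : IsTerminal (P.obj ((ihom X).obj (𝟙_ E))) :=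
    IsTerminal.isTerminalObj P _ (IsTerminal.isTerminalObj (ihom X) _ isTerminalTensorUnit)
  rw [P.map_comp] at h
  exact ⟨hT.ofIso ⟨P.map ((ihom X).map a), P.map ((ihom X).map (toUnit A)), hT.hom_ext _ _, h⟩⟩

lemma homotopic_of_isConnectedFor {X Y : E} (h : IsConnectedFor P ((ihom X).obj Y)) (f g : X ⟶ Y) :
    Homotopic p f g :=
  h.some.hom_ext _ _

lemma nonempty_point_of_isConnectedFor_ihom (hp : IsHomotopyTheory p) {A : E}
    (h : IsConnectedFor P ((ihom (𝟙_ E)).obj A)) : Nonempty (𝟙_ E ⟶ A) := by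
  obtain ⟨x, -⟩ := hp.surjective_points _ (h.some.from (𝟙_ E))
  exact ⟨x ≫ evalAt (𝟙 _) A⟩

theorem isContractible_tfae (hp : IsHomotopyTheory p) (A : E) : List.TFAE
    [IsContractible p A,
      ∀ X : E, IsIso (P.map (sigma A X)),
      ∀ X : E, IsConnectedFor P ((ihom X).obj A),
      Nonempty (𝟙_ E ⟶ A) ∧ IsConnectedFor P ((ihom A).obj A)] := by
  have := hp.preservesFiniteProducts
  tfae_have 1 ↔ 2 := isContractible_iff_isIso_map_sigma hp A
  tfae_have 1 → 3 := isConnectedFor_ihom_of_isContractible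
  tfae_have 3 → 4 := fun h ↦ ⟨nonempty_point_of_isConnectedFor_ihom hp (h _), h A⟩
  tfae_have 4 → 1 := fun ⟨⟨a⟩, h⟩ ↦ ⟨a, homotopic_of_isConnectedFor h _ _⟩
  tfae_finish

end HomotopyTheories

/-! ### Characteristic arrows tested on generalized elements. -/

section TruthValues

variable {E : Type u} [Category.{v} E] [HasSubobjectClassifier E]

open HasSubobjectClassifier

/-- The constant arrow with value true. -/
noncomputable def trueOn (W : E) : W ⟶ Ω E :=
  Subobject.Classifier.χ₀ _ W ≫ truth E

lemma comp_trueOn {V W : E} (w : V ⟶ W) : w ≫ trueOn W = trueOn V := by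
  rw [trueOn, ← Category.assoc]
  exact congrArg (· ≫ truth E) (Subsingleton.elim _ _)

lemma comp_truth {W : E} (w : W ⟶ Ω₀ E) : w ≫ truth E = trueOn W :=
  congrArg (· ≫ truth E) (Subsingleton.elim _ _)

lemma comp_χ_eq_trueOn_iff {M Z W : E} (m : M ⟶ Z) [Mono m] (w : W ⟶ Z) :
    w ≫ χ m = trueOn W ↔ ∃ u, u ≫ m = w := by
  constructor
  · intro h
    exact ⟨(isPullback_χ m).lift w _ h, (isPullback_χ m).lift_fst _ _ _⟩
  · rintro ⟨u, rfl⟩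
    rw [Category.assoc, HasSubobjectClassifier.comm, comp_truth, comp_trueOn]

variable [HasFiniteLimits E]

/-- Arrows to the subobject classifier are equal if they are true at the same generalized
elements. -/
lemma hom_ext_Ω {Z : E} {φ ψ : Z ⟶ Ω E}
    (h : ∀ (W : E) (w : W ⟶ Z), w ≫ φ = trueOn W ↔ w ≫ ψ = trueOn W) : φ = ψ := by
  -- Any `θ` with the same true elements as `φ` classifies the subobject classified by `φ`.
  have key : ∀ θ : Z ⟶ Ω E, (∀ (W : E) (w : W ⟶ Z), w ≫ φ = trueOn W ↔ w ≫ θ = trueOn W) →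
      θ = χ (pullback.fst φ (truth E)) := by
    intro θ hθ
    refine unique _ _ ⟨⟨?_⟩, ⟨PullbackCone.IsLimit.mk _
      (fun s ↦ pullback.lift s.fst s.snd ?_) (fun s ↦ pullback.lift_fst _ _ _) (fun s ↦ Subsingleton.elim _ _)
      fun s m h₁ _ ↦ ?_⟩⟩
    · exact (hθ _ _).1 (pullback.condition.trans (comp_truth _))
    · rw [comp_truth]
      exact (hθ _ _).2 (s.condition.trans (comp_truth _))
    · rw [← cancel_mono (pullback.fst φ (truth E)), h₁, pullback.lift_fst]
  rw [key φ fun _ _ ↦ Iff.rfl, ← key ψ h]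

end TruthValues

/-! ### Case analysis along an arrow to `1 + 1`. -/

section Two

variable {E : Type u} [Category.{v} E] [CartesianMonoidalCategory E] [MonoidalClosed E]
  {T : E} {i j : 𝟙_ E ⟶ T}

/-- By cartesian closedness `Z ⊗ T` is a coproduct of two copies of `Z`. -/
lemma exists_desc_tensor (hT : IsColimit (BinaryCofan.mk i j)) {Z Y : E} (f g : Z ⟶ Y) :
    ∃ h : Z ⊗ T ⟶ Y, (∀ (W : E) (w : W ⟶ Z), lift w (toUnit W ≫ i) ≫ h = w ≫ f) ∧
      ∀ (W : E) (w : W ⟶ Z), lift w (toUnit W ≫ j) ≫ h = w ≫ g := by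
  let k : T ⟶ (ihom Z).obj Y :=
    hT.desc (BinaryCofan.mk (internalizeHom f) (internalizeHom g))
  have hi : i ≫ k = internalizeHom f := hT.fac _ ⟨WalkingPair.left⟩
  have hj : j ≫ k = internalizeHom g := hT.fac _ ⟨WalkingPair.right⟩
  refine ⟨MonoidalClosed.uncurry k, fun W w ↦ ?_, fun W w ↦ ?_⟩
  · rw [MonoidalClosed.uncurry_eq, lift_whiskerLeft_assoc, Category.assoc, hi,
      lift_internalizeHom_ev]
  · rw [MonoidalClosed.uncurry_eq, lift_whiskerLeft_assoc, Category.assoc, hj,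
      lift_internalizeHom_ev]

lemma tensor_hom_ext (hT : IsColimit (BinaryCofan.mk i j)) {Z Y : E} {f g : Z ⊗ T ⟶ Y}
    (hi : lift (𝟙 Z) (toUnit Z ≫ i) ≫ f = lift (𝟙 Z) (toUnit Z ≫ i) ≫ g)
    (hj : lift (𝟙 Z) (toUnit Z ≫ j) ≫ f = lift (𝟙 Z) (toUnit Z ≫ j) ≫ g) : f = g := by
  have h : ∀ t : 𝟙_ E ⟶ T, Z ◁ t = fst Z (𝟙_ E) ≫ lift (𝟙 Z) (toUnit Z ≫ t) := by
    intro t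
    ext
    · simp
    · rw [whiskerLeft_snd, Category.assoc, lift_snd, ← Category.assoc]
      exact congrArg (· ≫ t) (toUnit_unique _ _)
  apply MonoidalClosed.curry_injective
  refine BinaryCofan.IsColimit.hom_ext hT ?_ ?_
  · change i ≫ _ = i ≫ _
    rw [← MonoidalClosed.curry_natural_left, ← MonoidalClosed.curry_natural_left, h,
      Category.assoc, hi, Category.assoc]
  · change j ≫ _ = j ≫ _
    rw [← MonoidalClosed.curry_natural_left, ← MonoidalClosed.curry_natural_left, h,
      Category.assoc, hj, Category.assoc]

/-- If the two points of `1 + 1` agree at stage `W` then parallel arrows out of `W` are equal. -/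
lemma hom_eq_of_inl_eq_inr (hT : IsColimit (BinaryCofan.mk i j)) {W Y : E}
    (hW : toUnit W ≫ i = toUnit W ≫ j) (f g : W ⟶ Y) : f = g := by
  obtain ⟨h, hf, hg⟩ := exists_desc_tensor hT f g
  rw [← Category.id_comp f, ← hf, hW, hg, Category.id_comp]

variable [HasSubobjectClassifier E]

open HasSubobjectClassifier

/-- Parallel arrows out of `W` being equal, `snd Y W` is monic and its characteristic arrow is true,
so it has a section. -/
lemma nonempty_hom_of_inl_eq_inr (hT : IsColimit (BinaryCofan.mk i j)) {W : E}
    (hW : toUnit W ≫ i = toUnit W ≫ j) (Y : E) : Nonempty (W ⟶ Y) := by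
  have : Mono (snd Y W) := by
    refine ⟨fun {V} g h _ ↦ hom_eq_of_inl_eq_inr hT ?_ g h⟩
    rw [← comp_toUnit (g ≫ snd Y W), Category.assoc, hW, ← Category.assoc]
  obtain ⟨u, -⟩ := (comp_χ_eq_trueOn_iff (snd Y W) (𝟙 W)).1 (hom_eq_of_inl_eq_inr hT hW _ _)
  exact ⟨u ≫ fst Y W⟩

variable [HasFiniteLimits E]

/-- The pullbacks of the two points of `1 + 1` along `t : U ⟶ 1 + 1` cover `U`. -/
lemma hom_ext_of_cover (hT : IsColimit (BinaryCofan.mk i j)) {U Y : E} (t : U ⟶ T) {f g : U ⟶ Y}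
    (hi : ∀ (W : E) (w : W ⟶ U), w ≫ t = toUnit W ≫ i → w ≫ f = w ≫ g)
    (hj : ∀ (W : E) (w : W ⟶ U), w ≫ t = toUnit W ≫ j → w ≫ f = w ≫ g) : f = g := by
  -- The equalizer and `U`, embedded in `U ⊗ T` by the graph of `t`, have the same fibres over `i`
  -- and `j`, hence the same characteristic arrow.
  let e := equalizer.ι f g
  let m : equalizer f g ⟶ U ⊗ T := lift e (e ≫ t)
  let n : U ⟶ U ⊗ T := lift (𝟙 U) t
  have aux : ∀ s : 𝟙_ E ⟶ T,
      (∀ (W : E) (w : W ⟶ U), w ≫ t = toUnit W ≫ s → w ≫ f = w ≫ g) →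
      lift (𝟙 U) (toUnit U ≫ s) ≫ χ m = lift (𝟙 U) (toUnit U ≫ s) ≫ χ n := by
    intro s hs
    apply hom_ext_Ω
    intro W w
    rw [← Category.assoc, ← Category.assoc, comp_χ_eq_trueOn_iff, comp_χ_eq_trueOn_iff]
    constructor
    · rintro ⟨u, hu⟩
      refine ⟨u ≫ e, ?_⟩
      rw [← hu]
      simp [m, n]
    · rintro ⟨u, hu⟩
      have h₁ : u = w := by simpa [n] using congrArg (· ≫ fst U T) hu
      have h₂ : u ≫ t = toUnit W ≫ s := by
        simpa [n] using congrArg (· ≫ snd U T) hu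
      refine ⟨equalizer.lift u (hs W u h₂), ?_⟩
      rw [← hu]
      simp [m, n, e]
  have hmn : χ m = χ n := tensor_hom_ext hT (aux i hi) (aux j hj)
  have h : n ≫ χ m = trueOn U := by
    rw [hmn, comp_χ_eq_trueOn_iff]
    exact ⟨𝟙 U, Category.id_comp n⟩
  obtain ⟨u, hu⟩ := (comp_χ_eq_trueOn_iff m n).1 h
  have hu' : u ≫ e = 𝟙 U := by simpa [m, n] using congrArg (· ≫ fst U T) hu
  rw [← Category.id_comp f, ← Category.id_comp g, ← hu', Category.assoc, Category.assoc,
    equalizer.condition]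

/-- Arrows defined on the two pullbacks of the points of `1 + 1` along `h : Z ⟶ 1 + 1` can be
glued to an arrow defined on `Z`. -/
lemma exists_glue (hT : IsColimit (BinaryCofan.mk i j)) {Z A C Y : E} (h : Z ⟶ T)
    {a : A ⟶ Z} {c : C ⟶ Z} (ha : IsPullback a (toUnit A) h i)
    (hc : IsPullback c (toUnit C) h j) (f : A ⟶ Y) (g : C ⟶ Y) :
    ∃ k : Z ⟶ Y, a ≫ k = f ∧ c ≫ k = g := by
  have : Mono i := isTerminalTensorUnit.mono_from i
  have : Mono j := isTerminalTensorUnit.mono_from j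
  have : Mono a := MorphismProperty.of_isPullback (P := .monomorphisms E) ha.flip ‹Mono i›
  have : Mono c := MorphismProperty.of_isPullback (P := .monomorphisms E) hc.flip ‹Mono j›
  obtain ⟨θ, hθf, hθg⟩ := exists_desc_tensor hT (χ (lift a f)) (χ (lift c g))
  -- `κ` classifies the graph of the arrow sought: that of `f` where `h` is `i`, that of `g` where
  -- `h` is `j`. Its projection to `Z` is shown monic (single-valued) and then split (total).
  let κ : Z ⊗ Y ⟶ Ω E := lift (𝟙 _) (fst Z Y ≫ h) ≫ θ
  have hκi : ∀ (W : E) (z : W ⟶ Z) (y : W ⟶ Y), z ≫ h = toUnit W ≫ i →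
      (lift z y ≫ κ = trueOn W ↔ ∃ u, u ≫ a = z ∧ u ≫ f = y) := by
    intro W z y hz
    have : lift z y ≫ κ = lift z y ≫ χ (lift a f) := by
      rw [← hθf, ← hz, ← Category.assoc]
      congr 1
      ext <;> simp
    rw [this, comp_χ_eq_trueOn_iff]
    refine exists_congr fun u ↦ ⟨fun hu ↦ ?_, fun hu ↦ by simp [hu.1, hu.2]⟩
    exact ⟨by simpa using congrArg (· ≫ fst Z Y) hu, by simpa using congrArg (· ≫ snd Z Y) hu⟩
  have hκj : ∀ (W : E) (z : W ⟶ Z) (y : W ⟶ Y), z ≫ h = toUnit W ≫ j →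
      (lift z y ≫ κ = trueOn W ↔ ∃ u, u ≫ c = z ∧ u ≫ g = y) := by
    intro W z y hz
    have : lift z y ≫ κ = lift z y ≫ χ (lift c g) := by
      rw [← hθg, ← hz, ← Category.assoc]
      congr 1
      ext <;> simp
    rw [this, comp_χ_eq_trueOn_iff]
    refine exists_congr fun u ↦ ⟨fun hu ↦ ?_, fun hu ↦ by simp [hu.1, hu.2]⟩
    exact ⟨by simpa using congrArg (· ≫ fst Z Y) hu, by simpa using congrArg (· ≫ snd Z Y) hu⟩
  let m : pullback κ (truth E) ⟶ Z ⊗ Y := pullback.fst κ (truth E)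
  have hm : ∀ (W : E) (w : W ⟶ Z ⊗ Y), w ≫ κ = trueOn W → ∃ u, u ≫ m = w := fun W w hw ↦
    ⟨pullback.lift w (Subobject.Classifier.χ₀ _ W) hw, pullback.lift_fst _ _ _⟩
  have hm' : m ≫ κ = trueOn _ := pullback.condition.trans (comp_truth _)
  have hmono : Mono (m ≫ fst Z Y) := by
    refine ⟨fun {W} u v huv ↦ ?_⟩
    have h₁ : u ≫ m ≫ fst Z Y = v ≫ m ≫ fst Z Y := by simpa using huv
    rw [← cancel_mono m]
    apply CartesianMonoidalCategory.hom_ext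
    · simpa using h₁
    · have key : ∀ (V : E) (w : V ⟶ W) (u : W ⟶ pullback κ (truth E)),
          lift (w ≫ u ≫ m ≫ fst Z Y) (w ≫ u ≫ m ≫ snd Z Y) ≫ κ = trueOn V := by
        intro V w u
        have : lift (w ≫ u ≫ m ≫ fst Z Y) (w ≫ u ≫ m ≫ snd Z Y) = w ≫ u ≫ m := by
          ext <;> simp
        rw [this, Category.assoc, Category.assoc, hm', comp_trueOn, comp_trueOn]
      refine hom_ext_of_cover hT (u ≫ m ≫ fst Z Y ≫ h) (fun V w hw ↦ ?_) (fun V w hw ↦ ?_)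
      · obtain ⟨r, hr, hr'⟩ := (hκi V _ _ (by simpa using hw)).1 (key V w u)
        obtain ⟨s, hs, hs'⟩ := (hκi V _ _ (by simpa [← h₁] using hw)).1 (key V w v)
        have : r = s := by rw [← cancel_mono a, hr, hs, h₁]
        simp only [Category.assoc]
        rw [← hr', ← hs', this]
      · obtain ⟨r, hr, hr'⟩ := (hκj V _ _ (by simpa using hw)).1 (key V w u)
        obtain ⟨s, hs, hs'⟩ := (hκj V _ _ (by simpa [← h₁] using hw)).1 (key V w v)
        have : r = s := by rw [← cancel_mono c, hr, hs, h₁]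
        simp only [Category.assoc]
        rw [← hr', ← hs', this]
  have htrue : 𝟙 Z ≫ χ (m ≫ fst Z Y) = trueOn Z := by
    rw [Category.id_comp]
    refine hom_ext_of_cover hT h (fun W w hw ↦ ?_) (fun W w hw ↦ ?_)
    · rw [comp_trueOn, comp_χ_eq_trueOn_iff]
      obtain ⟨u, hu⟩ := hm W (lift w (ha.lift w (toUnit W) hw ≫ f))
        ((hκi W _ _ hw).2 ⟨_, ha.lift_fst _ _ _, rfl⟩)
      exact ⟨u, by rw [reassoc_of% hu, lift_fst]⟩
    · rw [comp_trueOn, comp_χ_eq_trueOn_iff]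
      obtain ⟨u, hu⟩ := hm W (lift w (hc.lift w (toUnit W) hw ≫ g))
        ((hκj W _ _ hw).2 ⟨_, hc.lift_fst _ _ _, rfl⟩)
      exact ⟨u, by rw [reassoc_of% hu, lift_fst]⟩
  obtain ⟨s, hs⟩ := (comp_χ_eq_trueOn_iff _ _).1 htrue
  have hsκ : ∀ (W : E) (w : W ⟶ Z), lift w (w ≫ s ≫ m ≫ snd Z Y) ≫ κ = trueOn W := by
    intro W w
    have : lift w (w ≫ s ≫ m ≫ snd Z Y) = w ≫ s ≫ m := by
      ext <;> simp [hs]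
    rw [this, Category.assoc, Category.assoc, hm', comp_trueOn, comp_trueOn]
  refine ⟨s ≫ m ≫ snd Z Y, ?_, ?_⟩
  · obtain ⟨u, hu, hu'⟩ := (hκi A a _ ha.w).1 (hsκ A a)
    rw [← hu', (cancel_mono a).1 (hu.trans (Category.id_comp a).symm), Category.id_comp]
  · obtain ⟨u, hu, hu'⟩ := (hκj C c _ hc.w).1 (hsκ C c)
    rw [← hu', (cancel_mono c).1 (hu.trans (Category.id_comp c).symm), Category.id_comp]

/-- The pullbacks of the two points of `1 + 1` along an arrow `Z ⟶ 1 + 1` form a coproduct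
decomposition of `Z`. -/
lemma nonempty_isColimit_of_isPullback (hT : IsColimit (BinaryCofan.mk i j)) {Z A C : E}
    (h : Z ⟶ T) {a : A ⟶ Z} {c : C ⟶ Z} (ha : IsPullback a (toUnit A) h i)
    (hc : IsPullback c (toUnit C) h j) : Nonempty (IsColimit (BinaryCofan.mk a c)) := by
  refine ⟨BinaryCofan.IsColimit.mk _ (fun f g ↦ (exists_glue hT h ha hc f g).choose)
    (fun f g ↦ (exists_glue hT h ha hc f g).choose_spec.1)
    (fun f g ↦ (exists_glue hT h ha hc f g).choose_spec.2) fun f g k hk₁ hk₂ ↦ ?_⟩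
  obtain ⟨h₁, h₂⟩ := (exists_glue hT h ha hc f g).choose_spec
  change Z ⟶ _ at k
  change a ≫ k = f at hk₁
  change c ≫ k = g at hk₂
  refine hom_ext_of_cover hT h (fun W w hw ↦ ?_) (fun W w hw ↦ ?_)
  · rw [← ha.lift_fst w (toUnit W) hw, Category.assoc, Category.assoc, h₁, hk₁]
  · rw [← hc.lift_fst w (toUnit W) hw, Category.assoc, Category.assoc, h₂, hk₂]

end Two

variable {E : Type u} [Category.{v} E]

lemma app_map {P : E ⥤ E} {X Y : E} (p : 𝟭 E ⟶ P) (f : X ⟶ Y) : p.app X ≫ P.map f = f ≫ p.app Y :=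
  (p.naturality f).symm

variable [CartesianMonoidalCategory E]

/-! ### Decidability as an equality test valued in `1 + 1`. -/

section EqualityTests

variable {T : E} {i j : 𝟙_ E ⟶ T}

/-- `e : X ⊗ X ⟶ T` decides equality of generalized elements of `X`, with the point `i` of `T`
standing for equality. -/
def IsEqualityTest (i : 𝟙_ E ⟶ T) {X : E} (e : X ⊗ X ⟶ T) : Prop :=
  ∀ (W : E) (x y : W ⟶ X), lift x y ≫ e = toUnit W ≫ i ↔ x = y

lemma IsEqualityTest.comp_mono {X U : E} {e : X ⊗ X ⟶ T} (he : IsEqualityTest i e) (m : U ⟶ X)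
    [Mono m] : IsEqualityTest i ((m ⊗ₘ m) ≫ e) := by
  intro W x y
  rw [lift_map_assoc, he, cancel_mono]

lemma isEqualityTest_unit (i : 𝟙_ E ⟶ T) :
    IsEqualityTest i (toUnit (𝟙_ E ⊗ 𝟙_ E) ≫ i) := by
  intro W x y
  rw [← Category.assoc, comp_toUnit]
  exact ⟨fun _ ↦ toUnit_unique _ _, fun _ ↦ rfl⟩

variable [MonoidalClosed E] [HasFiniteLimits E] [HasSubobjectClassifier E]

open HasSubobjectClassifier

lemma isDecidable_of_isEqualityTest (hT : IsColimit (BinaryCofan.mk i j)) {X : E} {e : X ⊗ X ⟶ T}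
    (he : IsEqualityTest i e) : IsDecidable X := by
  refine ⟨pullback e j, pullback.fst e j, nonempty_isColimit_of_isPullback hT e ?_ ?_⟩
  · refine ⟨⟨(he X _ _).2 rfl⟩, ⟨PullbackCone.IsLimit.mk _ (fun s ↦ s.fst ≫ fst X X)
      (fun s ↦ ?_) (fun s ↦ toUnit_unique _ _) fun s m h _ ↦ ?_⟩⟩
    · have h := s.condition
      rw [← lift_comp_fst_snd s.fst, toUnit_unique s.snd (toUnit _), he] at h
      ext <;> simp [h]
    · rw [← h]
      simp
  · rw [← toUnit_unique (pullback.snd e j) (toUnit _)]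
    exact IsPullback.of_hasPullback e j

lemma IsDecidable.exists_isEqualityTest (hT : IsColimit (BinaryCofan.mk i j)) {X : E}
    (hX : IsDecidable X) : ∃ e : X ⊗ X ⟶ T, IsEqualityTest i e := by
  obtain ⟨C, c, ⟨hc⟩⟩ := hX
  let δ : X ⟶ X ⊗ X := lift (𝟙 X) (𝟙 X)
  change IsColimit (BinaryCofan.mk δ c) at hc
  let e : X ⊗ X ⟶ T := hc.desc (BinaryCofan.mk (toUnit X ≫ i) (toUnit C ≫ j))
  have hδe : δ ≫ e = toUnit X ≫ i := hc.fac _ ⟨WalkingPair.left⟩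
  have hce : c ≫ e = toUnit C ≫ j := hc.fac _ ⟨WalkingPair.right⟩
  have : Mono i := isTerminalTensorUnit.mono_from i
  -- Disjointness of the summands is not presupposed: on the complement both sides are true exactly
  -- at the stages where `i` and `j` agree.
  have key : χ δ = e ≫ χ i := by
    refine BinaryCofan.IsColimit.hom_ext hc ?_ ?_
    · change δ ≫ χ δ = δ ≫ e ≫ χ i
      rw [reassoc_of% hδe, (comp_χ_eq_trueOn_iff δ δ).2 ⟨𝟙 X, Category.id_comp δ⟩,
        (comp_χ_eq_trueOn_iff i i).2 ⟨𝟙 _, Category.id_comp i⟩, comp_trueOn]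
    · change c ≫ χ δ = c ≫ e ≫ χ i
      apply hom_ext_Ω
      intro W w
      rw [reassoc_of% hce, ← Category.assoc, ← Category.assoc, ← Category.assoc,
        comp_χ_eq_trueOn_iff, comp_χ_eq_trueOn_iff, comp_toUnit]
      constructor
      · rintro ⟨u, hu⟩
        refine ⟨toUnit W, ?_⟩
        have := congrArg (· ≫ e) hu
        simp only [Category.assoc, hδe, hce] at this
        simpa [← Category.assoc, toUnit_unique (u ≫ toUnit X) (toUnit W),
          toUnit_unique (w ≫ toUnit C) (toUnit W)] using this
      · rintro ⟨u, hu⟩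
        rw [toUnit_unique u (toUnit W)] at hu
        exact ⟨w ≫ c ≫ fst X X, hom_eq_of_inl_eq_inr hT hu _ _⟩
  refine ⟨e, fun W x y ↦ ⟨fun h ↦ ?_, ?_⟩⟩
  · have h' : lift x y ≫ χ δ = trueOn W := by
      rw [key, ← Category.assoc, h, comp_χ_eq_trueOn_iff]
      exact ⟨_, rfl⟩
    obtain ⟨u, hu⟩ := (comp_χ_eq_trueOn_iff _ _).1 h'
    have h₁ : u = x := by simpa [δ] using congrArg (· ≫ fst X X) hu
    have h₂ : u = y := by simpa [δ] using congrArg (· ≫ snd X X) hu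
    exact h₁.symm.trans h₂
  · rintro rfl
    have : lift x x = x ≫ δ := by ext <;> simp [δ]
    rw [this, Category.assoc, hδe, ← Category.assoc, comp_toUnit]

lemma IsDecidable.of_mono (hT : IsColimit (BinaryCofan.mk i j)) {X U : E} (hX : IsDecidable X)
    (m : U ⟶ X) [Mono m] : IsDecidable U := by
  obtain ⟨e, he⟩ := hX.exists_isEqualityTest hT
  exact isDecidable_of_isEqualityTest hT (he.comp_mono m)

lemma isDecidable_unit (hT : IsColimit (BinaryCofan.mk i j)) : IsDecidable (𝟙_ E) :=
  isDecidable_of_isEqualityTest hT (isEqualityTest_unit i)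

/-- Conjunction on `1 + 1`, with `i` as the value true. -/
lemma exists_conj (hT : IsColimit (BinaryCofan.mk i j)) : ∃ k : T ⊗ T ⟶ T,
    (∀ (W : E) (s : W ⟶ T), lift (toUnit W ≫ j) s ≫ k = toUnit W ≫ j) ∧
    ∀ (W : E) (s t : W ⟶ T),
      lift s t ≫ k = toUnit W ≫ i ↔ s = toUnit W ≫ i ∧ t = toUnit W ≫ i := by
  obtain ⟨k, hki, hkj⟩ := exists_desc_tensor hT (𝟙 T) (toUnit T ≫ j)
  refine ⟨k, fun W s ↦ ?_, fun W s t ↦ ⟨fun h ↦ ?_, ?_⟩⟩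
  · refine hom_ext_of_cover hT s (fun V w hw ↦ ?_) (fun V w hw ↦ ?_)
    · rw [comp_lift_assoc, hw, hki]
      simp
    · rw [comp_lift_assoc, hw, hkj]
      simp [← Category.assoc]
  · have hj : ∀ (V : E) (w : V ⟶ W), w ≫ t = toUnit V ≫ j → toUnit V ≫ i = toUnit V ≫ j := by
      intro V w hw
      have := congrArg (w ≫ ·) h
      simp only [comp_lift_assoc, hw, hkj] at this
      rw [← Category.assoc, ← Category.assoc, comp_toUnit, comp_toUnit] at this
      exact this.symm
    constructor
    · refine hom_ext_of_cover hT t (fun V w hw ↦ ?_)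
        fun V w hw ↦ hom_eq_of_inl_eq_inr hT (hj V w hw) _ _
      have := congrArg (w ≫ ·) h
      simpa only [comp_lift_assoc, hw, hki, Category.comp_id] using this
    · refine hom_ext_of_cover hT t (fun V w hw ↦ ?_)
        fun V w hw ↦ hom_eq_of_inl_eq_inr hT (hj V w hw) _ _
      rw [hw, ← Category.assoc, comp_toUnit]
  · rintro ⟨rfl, rfl⟩
    rw [hki, Category.comp_id]

lemma IsDecidable.tensor (hT : IsColimit (BinaryCofan.mk i j)) {X Y : E} (hX : IsDecidable X)
    (hY : IsDecidable Y) : IsDecidable (X ⊗ Y) := by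
  obtain ⟨k, -, hk⟩ := exists_conj hT
  obtain ⟨e, he⟩ := hX.exists_isEqualityTest hT
  obtain ⟨e', he'⟩ := hY.exists_isEqualityTest hT
  refine isDecidable_of_isEqualityTest hT
    (e := lift ((fst X Y ⊗ₘ fst X Y) ≫ e) ((snd X Y ⊗ₘ snd X Y) ≫ e') ≫ k) fun W x y ↦ ?_
  rw [comp_lift_assoc, hk, lift_map_assoc, lift_map_assoc, he, he']
  exact ⟨fun h ↦ CartesianMonoidalCategory.hom_ext _ _ h.1 h.2, by rintro rfl; simp⟩

end EqualityTests

/-! ### Decidable objects and their points under NS and DSO. -/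

section Points

variable [MonoidalClosed E] [HasFiniteLimits E] [HasSubobjectClassifier E]
  {T : E} {i j : 𝟙_ E ⟶ T}

/-- Under the Nullstellensatz, arrows to a decidable object are determined by their values at
points. -/
lemma IsDecidable.hom_ext_of_points (hT : IsColimit (BinaryCofan.mk i j)) (hNS : NS E) {X D : E}
    (hD : IsDecidable D) {f g : X ⟶ D} (h : ∀ x : 𝟙_ E ⟶ X, x ≫ f = x ≫ g) : f = g := by
  obtain ⟨e, he⟩ := hD.exists_isEqualityTest hT
  refine hom_ext_of_cover hT (lift f g ≫ e) (fun W w hw ↦ ?_) (fun W w hw ↦ ?_)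
  · rwa [comp_lift_assoc, he] at hw
  · by_cases hW : Nonempty (IsInitial W)
    · exact hW.some.hom_ext _ _
    · obtain ⟨a⟩ := hNS W hW
      have h₁ : lift (a ≫ w ≫ f) (a ≫ w ≫ g) ≫ e = toUnit _ ≫ i := by
        rw [he]
        simpa using h (a ≫ w)
      have h₂ : lift (a ≫ w ≫ f) (a ≫ w ≫ g) ≫ e = toUnit _ ≫ j := by
        have := congrArg (a ≫ ·) hw
        simp only [comp_lift_assoc] at this
        rw [this, ← Category.assoc, comp_toUnit]
      have h₃ : toUnit (𝟙_ E) ≫ i = toUnit (𝟙_ E) ≫ j := h₁.symm.trans h₂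
      refine hom_eq_of_inl_eq_inr hT ?_ _ _
      rw [← comp_toUnit (toUnit W), Category.assoc, h₃, Category.assoc]

lemma mono_of_injective_points (hT : IsColimit (BinaryCofan.mk i j)) (hNS : NS E) {U V : E}
    (hU : IsDecidable U) (h : U ⟶ V)
    (hinj : Function.Injective fun x : 𝟙_ E ⟶ U ↦ x ≫ h) : Mono h := by
  refine ⟨fun {W} a b hab ↦ hU.hom_ext_of_points hT hNS fun w ↦ hinj ?_⟩
  simp only [Category.assoc, hab]

/-- The subobject `m` and the whole of `X` are both decidable and contain all points, so DSO
identifies them. -/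
lemma isIso_of_mono_of_surjective_points (hT : IsColimit (BinaryCofan.mk i j)) (hDSO : DSO E)
    {U X : E} (hX : IsDecidable X) (m : U ⟶ X) [Mono m]
    (hm : Function.Surjective fun x : 𝟙_ E ⟶ U ↦ x ≫ m) : IsIso m := by
  rw [Subobject.isIso_iff_mk_eq_top]
  refine (hDSO X).unique ⟨hX.of_mono hT (Subobject.arrow _), fun x ↦ ?_⟩
    ⟨hX.of_mono hT (Subobject.arrow _), fun x ↦ Subobject.top_factors x⟩
  obtain ⟨u, hu⟩ := hm x
  exact (Subobject.mk_factors_iff m x).2 ⟨u, hu⟩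

lemma isIso_of_bijective_points (hT : IsColimit (BinaryCofan.mk i j)) (hNS : NS E) (hDSO : DSO E)
    {U V : E} (hU : IsDecidable U) (hV : IsDecidable V) (h : U ⟶ V)
    (hh : Function.Bijective fun x : 𝟙_ E ⟶ U ↦ x ≫ h) : IsIso h := by
  have := mono_of_injective_points hT hNS hU h hh.1
  exact isIso_of_mono_of_surjective_points hT hDSO hV h hh.2

end Points

/-! ### The decidable reflection and its preservation of products. -/

section Reflection

variable {T : E} {i j : 𝟙_ E ⟶ T}

lemma UniquelyFactorsArrowsToTwo.existsUnique (hT : IsColimit (BinaryCofan.mk i j)) {X D : E}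
    {p : X ⟶ D} (hp : UniquelyFactorsArrowsToTwo p) (f : X ⟶ T) : ∃! g : D ⟶ T, p ≫ g = f := by
  obtain ⟨T', i', j', ⟨hT'⟩, h⟩ := hp
  let e : T ≅ T' := hT.coconePointUniqueUpToIso hT'
  obtain ⟨g, hg, hu⟩ := h (f ≫ e.hom)
  refine ⟨g ≫ e.inv, ?_, fun g' hg' ↦ ?_⟩
  · simp only [reassoc_of% hg, e.hom_inv_id, Category.comp_id]
  · rw [← hu (g' ≫ e.hom) (by simp only [reassoc_of% hg'])]
    simp

variable [MonoidalClosed E] [HasFiniteLimits E] [HasSubobjectClassifier E]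

/-- A missed point `y` splits off from `D`, and `p` factors through its complement, which still
factors arrows to `1 + 1` uniquely. This contradicts minimality unless `1 + 1` is degenerate. -/
lemma IsMinimalDecidable.surjective_points (hT : IsColimit (BinaryCofan.mk i j)) (hNS : NS E)
    {X D : E} {p : X ⟶ D} (hp : IsMinimalDecidable p) :
    Function.Surjective fun x : 𝟙_ E ⟶ X ↦ x ≫ p := by
  intro y
  by_contra hy
  obtain ⟨e, he⟩ := hp.isDecidable.exists_isEqualityTest hT
  let h : D ⟶ T := lift (toUnit D ≫ y) (𝟙 D) ≫ e
  have hh : ∀ (W : E) (d : W ⟶ D), d ≫ h = lift (toUnit W ≫ y) d ≫ e := by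
    intro W d
    rw [comp_lift_assoc, ← Category.assoc, comp_toUnit, Category.comp_id]
  have hyh : y ≫ h = toUnit _ ≫ i := by
    rw [hh, he, toUnit_unit, Category.id_comp]
  let m : pullback h j ⟶ D := pullback.fst h j
  have hm : IsPullback m (toUnit _) h j := by
    rw [← toUnit_unique (pullback.snd h j) (toUnit _)]
    exact IsPullback.of_hasPullback h j
  have : Mono j := isTerminalTensorUnit.mono_from j
  have hmono : Mono m := inferInstance
  have hpb : IsPullback y (toUnit _) h i := by
    refine ⟨⟨hyh⟩, ⟨PullbackCone.IsLimit.mk _ (fun s ↦ toUnit _) (fun s ↦ ?_)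
      (fun s ↦ toUnit_unique _ _) fun s m _ _ ↦ toUnit_unique _ _⟩⟩
    have := s.condition
    rwa [hh, toUnit_unique s.snd (toUnit _), he] at this
  have hph : p ≫ h = toUnit X ≫ j := by
    refine hom_ext_of_cover hT (p ≫ h) (fun W w hw ↦ ?_) (fun W w hw ↦ ?_)
    -- A point of `W` would give a point of `X` over `y`, so `W` is initial by NS.
    · by_cases hW : Nonempty (IsInitial W)
      · exact hW.some.hom_ext _ _
      · obtain ⟨a⟩ := hNS W hW
        refine (hy ⟨a ≫ w, ?_⟩).elim
        rw [← Category.assoc, hh, he] at hw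
        dsimp only
        rw [Category.assoc, ← hw, ← Category.assoc, comp_toUnit, toUnit_unit, Category.id_comp]
    · rw [hw, ← Category.assoc, comp_toUnit]
  let q : X ⟶ pullback h j := hm.lift p (toUnit X) hph
  have hq : q ≫ m = p := hm.lift_fst _ _ _
  have hfac : UniquelyFactorsArrowsToTwo q := by
    refine ⟨T, i, j, ⟨hT⟩, fun f ↦ ?_⟩
    obtain ⟨g, hg, hu⟩ := hp.uniquelyFactors.existsUnique hT f
    -- A competitor on the complement extends to `D` with the arbitrary value `i` at `y`.
    have key : ∀ g' : pullback h j ⟶ T, q ≫ g' = f → g' = m ≫ g := by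
      intro g' hg'
      obtain ⟨k, -, hk⟩ := exists_glue hT h hpb hm i g'
      rw [← hk, hu k (by simp only [← hq, Category.assoc, hk, hg'])]
    exact ⟨m ≫ g, by simpa only [reassoc_of% hq] using hg, key⟩
  have := hp.minimal _ m q hmono hq (hp.isDecidable.of_mono hT m) hfac
  have hj : y ≫ h = toUnit _ ≫ j := by
    have : y = (y ≫ inv m) ≫ m := by simp
    rw [this, Category.assoc, hm.w, ← Category.assoc, comp_toUnit]
  have hij := hyh.symm.trans hj
  obtain ⟨x⟩ := nonempty_hom_of_inl_eq_inr hT hij X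
  exact hy ⟨x, hom_eq_of_inl_eq_inr hT hij _ _⟩

/-- Arrows to decidable objects respect the identifications of points made by `p`. -/
lemma IsMinimalDecidable.comp_eq_of_comp_eq (hT : IsColimit (BinaryCofan.mk i j))
    {X D Y : E} {p : X ⟶ D} (hp : IsMinimalDecidable p) (hY : IsDecidable Y) (f : X ⟶ Y)
    {x x' : 𝟙_ E ⟶ X} (h : x ≫ p = x' ≫ p) : x ≫ f = x' ≫ f := by
  -- Testing equality with the value of `f` at `x` is an arrow from `X` to `1 + 1`, so it factors
  -- through `p`.
  obtain ⟨e, he⟩ := hY.exists_isEqualityTest hT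
  obtain ⟨g, hg, -⟩ :=
    hp.uniquelyFactors.existsUnique hT (lift (toUnit X ≫ x ≫ f) f ≫ e)
  have key : ∀ z : 𝟙_ E ⟶ X, lift (x ≫ f) (z ≫ f) ≫ e = z ≫ p ≫ g := by
    intro z
    rw [hg, comp_lift_assoc, ← Category.assoc, comp_toUnit, toUnit_unit, Category.id_comp]
  rw [← he, key, ← reassoc_of% h, ← key, he]

lemma IsMinimalDecidable.exists_comp_eq (hT : IsColimit (BinaryCofan.mk i j)) (hNS : NS E)
    (hDSO : DSO E) {X D Y : E} {p : X ⟶ D} (hp : IsMinimalDecidable p) (hY : IsDecidable Y)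
    (f : X ⟶ Y) : ∃ g : D ⟶ Y, p ≫ g = f := by
  obtain ⟨k, hkj, hki⟩ := exists_conj hT
  obtain ⟨e, he⟩ := hp.isDecidable.exists_isEqualityTest hT
  obtain ⟨e', he'⟩ := hY.exists_isEqualityTest hT
  let φ : X ⊗ (D ⊗ Y) ⟶ T := lift (fst _ _ ≫ p) (snd _ _ ≫ fst _ _) ≫ e
  let ψ : X ⊗ (D ⊗ Y) ⟶ T := lift φ (lift (fst _ _ ≫ f) (snd _ _ ≫ snd _ _) ≫ e') ≫ k
  have hφ : ∀ (W : E) (x : W ⟶ X) (z : W ⟶ D) (y : W ⟶ Y),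
      lift x (lift z y) ≫ φ = lift (x ≫ p) z ≫ e := by
    intro W x z y
    simp [φ]
  have hψ : ∀ (W : E) (x : W ⟶ X) (z : W ⟶ D) (y : W ⟶ Y),
      lift x (lift z y) ≫ ψ = lift (lift (x ≫ p) z ≫ e) (lift (x ≫ f) y ≫ e') ≫ k := by
    intro W x z y
    rw [comp_lift_assoc, hφ]
    simp
  -- `J` consists of the pairs `(z, y)` such that `p x = z` implies `f x = y` for all `x`; the
  -- implication is the equation between `φ` and its conjunction with `f x = y`, and transposing
  -- quantifies over `x`. `J` will be the graph of the factorization.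
  let J : E := equalizer (MonoidalClosed.curry φ) (MonoidalClosed.curry ψ)
  let ι : J ⟶ D ⊗ Y := equalizer.ι _ _
  have hι : X ◁ ι ≫ φ = X ◁ ι ≫ ψ := by
    apply MonoidalClosed.curry_injective
    rw [MonoidalClosed.curry_natural_left, MonoidalClosed.curry_natural_left]
    exact equalizer.condition _ _
  have hJ : ∀ (x : 𝟙_ E ⟶ X) (s : 𝟙_ E ⟶ J), x ≫ p = s ≫ ι ≫ fst D Y →
      x ≫ f = s ≫ ι ≫ snd D Y := by
    intro x s hx
    have h := congrArg (lift x s ≫ ·) hι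
    have hs : s ≫ ι = lift (s ≫ ι ≫ fst D Y) (s ≫ ι ≫ snd D Y) := by ext <;> simp
    simp only [lift_whiskerLeft_assoc] at h
    rw [hs, hφ, hψ, (he _ _ _).2 hx] at h
    exact (he' _ _ _).1 ((hki _ _ _).1 h.symm).2
  have hJ' : ∀ x : 𝟙_ E ⟶ X, ∃ s : 𝟙_ E ⟶ J, s ≫ ι = lift (x ≫ p) (x ≫ f) := by
    intro x
    suffices X ◁ lift (x ≫ p) (x ≫ f) ≫ φ = X ◁ lift (x ≫ p) (x ≫ f) ≫ ψ by
      refine ⟨equalizer.lift (lift (x ≫ p) (x ≫ f)) ?_, equalizer.lift_ι _ _⟩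
      rw [← MonoidalClosed.curry_natural_left, ← MonoidalClosed.curry_natural_left, this]
    have hw : ∀ (W : E) (w : W ⟶ X ⊗ 𝟙_ E), w ≫ X ◁ lift (x ≫ p) (x ≫ f) =
        lift (w ≫ fst _ _) (lift (toUnit W ≫ x ≫ p) (toUnit W ≫ x ≫ f)) := by
      intro W w
      have := toUnit_unique (w ≫ snd _ _) (toUnit W)
      ext <;> simp [reassoc_of% this]
    refine hom_ext_of_cover hT (X ◁ lift (x ≫ p) (x ≫ f) ≫ φ) (fun W w h ↦ ?_) fun W w h ↦ ?_
    · rw [← Category.assoc, hw, hφ] at h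
      have h' : (w ≫ fst _ _) ≫ f = toUnit W ≫ x ≫ f := by
        refine hY.hom_ext_of_points hT hNS fun a ↦ ?_
        have ha := hp.comp_eq_of_comp_eq hT hY f (x := a ≫ w ≫ fst _ _) (x' := x) (by
          simpa using congrArg (a ≫ ·) ((he _ _ _).1 h))
        simpa using ha
      rw [← Category.assoc, ← Category.assoc w, hw, hφ, hψ, h, eq_comm, hki]
      exact ⟨rfl, (he' _ _ _).2 h'⟩
    · rw [← Category.assoc, hw, hφ] at h
      rw [← Category.assoc, ← Category.assoc w, hw, hφ, hψ, h, hkj]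
  have hmono : Mono (ι ≫ fst D Y) := by
    refine ⟨fun {W} a b hab ↦ ?_⟩
    rw [← cancel_mono ι]
    apply CartesianMonoidalCategory.hom_ext
    · simpa using hab
    · refine hY.hom_ext_of_points hT hNS fun w ↦ ?_
      obtain ⟨x, hx⟩ := hp.surjective_points hT hNS ((w ≫ a) ≫ ι ≫ fst D Y)
      have h₁ := hJ x (w ≫ a) hx
      have h₂ := hJ x (w ≫ b) (by rw [Category.assoc, ← hab, ← Category.assoc]; exact hx)
      simpa using h₁.symm.trans h₂
  have hiso : IsIso (ι ≫ fst D Y) := by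
    refine isIso_of_mono_of_surjective_points hT hDSO hp.isDecidable _ fun z ↦ ?_
    obtain ⟨x, rfl⟩ := hp.surjective_points hT hNS z
    obtain ⟨s, hs⟩ := hJ' x
    exact ⟨s, by simp [reassoc_of% hs]⟩
  refine ⟨inv (ι ≫ fst D Y) ≫ ι ≫ snd D Y, hY.hom_ext_of_points hT hNS fun x ↦ ?_⟩
  rw [hJ x (x ≫ p ≫ inv (ι ≫ fst D Y)) (by simp)]
  simp

lemma IsMinimalDecidable.hom_ext (hT : IsColimit (BinaryCofan.mk i j)) (hNS : NS E)
    {X D Y : E} {p : X ⟶ D} (hp : IsMinimalDecidable p) (hY : IsDecidable Y)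
    {f g : D ⟶ Y} (h : p ≫ f = p ≫ g) : f = g := by
  refine hY.hom_ext_of_points hT hNS fun z ↦ ?_
  obtain ⟨x, rfl⟩ := hp.surjective_points hT hNS z
  simp [h]

/-- The minimal decidable objects of the WDQO postulate are the components of a natural
transformation. -/
theorem exists_isAssociated (hT : IsColimit (BinaryCofan.mk i j)) (hNS : NS E) (hWDQO : WDQO E)
    (hDSO : DSO E) : ∃ (P : E ⥤ E) (p : 𝟭 E ⟶ P), IsAssociated p := by
  choose D p hp using hWDQO
  choose m hm using fun (X Y : E) (f : X ⟶ Y) ↦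
    (hp X).exists_comp_eq hT hNS hDSO (hp Y).isDecidable (f ≫ p Y)
  let P : E ⥤ E :=
    { obj := D
      map := fun {X Y} f ↦ m X Y f
      map_id := fun X ↦ (hp X).hom_ext hT hNS (hp X).isDecidable (by simp [hm])
      map_comp := fun {X Y Z} f g ↦ (hp X).hom_ext hT hNS (hp Z).isDecidable (by
        rw [hm, reassoc_of% hm X Y f, hm, Category.assoc]) }
  exact ⟨P, { app := p, naturality := fun X Y f ↦ (hm X Y f).symm }, hp⟩

variable {P : E ⥤ E} {p : 𝟭 E ⟶ P}

lemma IsAssociated.surjective_points (hT : IsColimit (BinaryCofan.mk i j)) (hNS : NS E)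
    (hp : IsAssociated p) (X : E) :
    Function.Surjective (fun x : 𝟙_ E ⟶ X ↦ (x ≫ p.app X : 𝟙_ E ⟶ P.obj X)) :=
  (hp X).surjective_points hT hNS

/-- For injectivity on points, the coordinates are changed one at a time, passing through the pair
of the first coordinate of `b` and the second of `a`. -/
lemma IsAssociated.isIso_prodComparison (hT : IsColimit (BinaryCofan.mk i j)) (hNS : NS E)
    (hDSO : DSO E) (hp : IsAssociated p) (X Y : E) :
    IsIso (CartesianMonoidalCategory.prodComparison P X Y) := by
  refine isIso_of_bijective_points hT hNS hDSO (hp _).isDecidable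
    ((hp X).isDecidable.tensor hT (hp Y).isDecidable) _ ⟨fun u v huv ↦ ?_, fun w ↦ ?_⟩
  · obtain ⟨a, rfl⟩ := hp.surjective_points hT hNS _ u
    obtain ⟨b, rfl⟩ := hp.surjective_points hT hNS _ v
    dsimp only at huv ⊢
    have h₁ : (a ≫ fst X Y) ≫ p.app X = (b ≫ fst X Y) ≫ p.app X := by
      simpa [app_map] using congrArg (· ≫ fst _ _) huv
    have h₂ : (a ≫ snd X Y) ≫ p.app Y = (b ≫ snd X Y) ≫ p.app Y := by
      simpa [app_map] using congrArg (· ≫ snd _ _) huv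
    have k₁ := (hp X).comp_eq_of_comp_eq (X := X) (D := P.obj X) hT (hp (X ⊗ Y)).isDecidable
      (lift (𝟙 X) (toUnit X ≫ a ≫ snd X Y) ≫ p.app (X ⊗ Y)) h₁
    have k₂ := (hp Y).comp_eq_of_comp_eq (X := Y) (D := P.obj Y) hT (hp (X ⊗ Y)).isDecidable
      (lift (toUnit Y ≫ b ≫ fst X Y) (𝟙 Y) ≫ p.app (X ⊗ Y)) h₂
    rw [comp_lift_assoc, comp_lift_assoc, point_comp_toUnit_comp, point_comp_toUnit_comp,
      Category.comp_id, Category.comp_id, lift_comp_fst_snd] at k₁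
    rw [comp_lift_assoc, comp_lift_assoc, point_comp_toUnit_comp, point_comp_toUnit_comp,
      Category.comp_id, Category.comp_id, lift_comp_fst_snd] at k₂
    exact k₁.trans k₂
  · obtain ⟨x, hx⟩ := hp.surjective_points hT hNS X (w ≫ fst _ _)
    obtain ⟨y, hy⟩ := hp.surjective_points hT hNS Y (w ≫ snd _ _)
    refine ⟨lift x y ≫ p.app (X ⊗ Y), ?_⟩
    dsimp only at hx hy ⊢
    ext
    · simp [app_map, hx]
    · simp [app_map, hy]

lemma IsAssociated.isIso_terminalComparison (hT : IsColimit (BinaryCofan.mk i j)) (hNS : NS E)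
    (hDSO : DSO E) (hp : IsAssociated p) : IsIso (CartesianMonoidalCategory.terminalComparison P) := by
  refine isIso_of_bijective_points hT hNS hDSO (hp _).isDecidable (isDecidable_unit hT) _
    ⟨fun u v _ ↦ ?_, fun w ↦ ⟨w ≫ p.app (𝟙_ E), toUnit_unique _ _⟩⟩
  obtain ⟨a, rfl⟩ := hp.surjective_points hT hNS _ u
  obtain ⟨b, rfl⟩ := hp.surjective_points hT hNS _ v
  rw [toUnit_unique a b]

theorem IsAssociated.isHomotopyTheory (hT : IsColimit (BinaryCofan.mk i j)) (hNS : NS E)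
    (hDSO : DSO E) (hp : IsAssociated p) : IsHomotopyTheory p where
  preservesFiniteProducts := by
    have := hp.isIso_prodComparison hT hNS hDSO
    have := hp.isIso_terminalComparison hT hNS hDSO
    have := preservesLimitsOfShape_discrete_walkingPair_of_isIso_prodComparison P
    have := preservesLimit_empty_of_isIso_terminalComparison P
    have := preservesLimitsOfShape_pempty_of_preservesTerminal P
    exact .of_preserves_binary_and_terminal P
  surjective_points := hp.surjective_points hT hNS

end Reflection

end HomotopyTheory

open HomotopyTheory in
theorem theoremD {E : Type u} [Category.{v} E] [CartesianMonoidalCategory E] [MonoidalClosed E] :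
    (∀ (P : E ⥤ E) (p : 𝟭 E ⟶ P), IsHomotopyTheory p →
      ∀ A : E, IsContractible p A ↔ ∀ X : E, IsIso (P.map (sigma A X))) ∧
    (IsElementaryTopos E → NS E → WDQO E → DSO E →
      (∃ (P : E ⥤ E) (p : 𝟭 E ⟶ P), IsAssociated p) ∧
      ∀ (P : E ⥤ E) (p : 𝟭 E ⟶ P), IsAssociated p →
        IsHomotopyTheory p ∧
        ∀ A : E, List.TFAE
          [IsContractible p A,
           ∀ X : E, IsIso (P.map (sigma A X)),
           ∀ X : E, IsConnectedFor P ((ihom X).obj A),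
           Nonempty (𝟙_ E ⟶ A) ∧ IsConnectedFor P ((ihom A).obj A)]) := by
  refine ⟨fun P p hp A ↦ isContractible_iff_isIso_map_sigma hp A, fun hE hNS hWDQO hDSO ↦ ?_⟩
  have := hE.hasFiniteLimits
  have := hE.hasSubobjectClassifier
  -- WDQO at the terminal object supplies the coproduct `1 + 1`.
  obtain ⟨_, _, hp⟩ := hWDQO (𝟙_ E)
  obtain ⟨T, i, j, ⟨hT⟩, -⟩ := hp.uniquelyFactors
  refine ⟨exists_isAssociated hT hNS hWDQO hDSO, fun P p hp ↦ ?_⟩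
  have h := hp.isHomotopyTheory hT hNS hDSO
  exact ⟨h, isContractible_tfae h⟩
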